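/- Let $\mathcal V$ be a finite set of time series; the series $X$ takes values in a countable (discrete) set $S_X$, and $X_t$ denotes its value at time $t\in\mathbb Z$. Fix a maximal lag $\gamma_{\max}\in\mathbb N$. **Graphs.** A full-time causal graph (FTCG) is an acyclic directed graph on the vertices $X_t$ ($X\in\mathcal V$, $t\in\mathbb Z$) whose edges $X_s\to Y_t$ satisfy $0\le t-s\le\gamma_{\max}$ and are invariant under time shifts. Its summary causal graph (SCG) is the directed graph on $\mathcal V$ with $X\to Y$ iff $X_{t-k}\to Y_t$ for some $0\le k\le\gamma_{\max}$. Its extended summary causal graph (ESCG) is the directed graph with two vertices $X_{t^-},X_t$ for each $X\in\mathcal V$, with $X_t\to Y_t$ iff this edge is in the FTCG, $X_{t^-}\to Y_t$ iff $X_{t-k}\to Y_t$ is in the FTCG for some $0<k\le\gamma_{\max}$, and no other edges. The candidate FTCGs of an ESCG or SCG $\mathcal G$ are the FTCGs from which $\mathcal G$ is derived; $\mathcal C(\mathcal G)$ is the set of them. A path between two vertices of an FTCG is a finite sequence of distinct vertices from one to the other in which successive vertices are adjacent; a backdoor path between $u$ and $v$ is one whose first edge points into $u$. A vertex $b$ with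 neighbours $a,c$ on a path is a collider if $a\to b\leftarrow c$, and a non-collider otherwise. A path between $u$ and $v$ is active given $\mathcal Z$ if $u,v\notin\mathcal Z$, no non-collider on it is in $\mathcal Z$, and every collider on it has a descendant in $\mathcal Z$; otherwise $\mathcal Z$ blocks it. A vertex is a descendant of itself. A set $\mathcal Z$ satisfies the backdoor criterion over all candidate FTCGs relative to $(X_{t-\gamma},Y_t)$ if in every FTCG in $\mathcal C(\mathcal G)$ it blocks all backdoor paths between $X_{t-\gamma}$ and $Y_t$ and contains no descendant of $X_{t-\gamma}$. **Models.** A dynamic structural causal model (DSCM) with FTCG $\mathcal G^f$ consists of jointly independent noises $U_{X,t}$, measurable structural functions $f_X$ that do not depend on time, and variables $X_t$, such that $X_t=f_X(\text{parents of }X_t\text{ in }\mathcal G^f,\,U_{X,t})$ for all $X,t$, and each $X_t$ is a measurable function of the noises of its ancestors in $\mathcal G^f$ (itself included). Thus there is no hidden common cause (causal sufficiency), and causal relations are constant throughout time (consistency throughout time). Its law $P$ is the joint distribution of all $X_t$; $P$ is positive if any finitely many variables take any prescribed values with positive probability. The total effect $P(y_t\mid do(x_{t-\gamma}))$ is the probability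 of $Y_t=y_t$ after the structural equation of $X_{t-\gamma}$ has been replaced by $X_{t-\gamma}=x_{t-\gamma}$, the values before time $t-\gamma$, the noises and all other structural equations being kept. It is identifiable in $\mathcal G$ if there is a do-free formula, i.e. a function of the observed law alone, that gives the total effect (for all values $x_{t-\gamma},y_t$) in every DSCM with positive law whose FTCG is any element of $\mathcal C(\mathcal G)$. **Statement.** Let $\mathcal G$ be the ESCG or SCG derived from the FTCG of a DSCM with positive law $P$, let $t\in\mathbb Z$, $\gamma\ge 0$, and let $X_{t-\gamma}\neq Y_t$ be distinct vertices. If a finite set $\mathcal Z$ satisfies the backdoor criterion over all candidate FTCGs relative to $(X_{t-\gamma},Y_t)$, then the total effect of $X_{t-\gamma}$ on $Y_t$ is identifiable in $\mathcal G$, and $\mathcal Z$ is a valid adjustment set: for all values $x_{t-\gamma}$ and $y_t$, $$P(y_t\mid do(x_{t-\gamma}))=\sum_{\mathbf z}P(y_t\mid x_{t-\gamma},\mathbf z)\,P(\mathbf z).$$ -/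

import Mathlib

open MeasureTheory ProbabilityTheory

universe w

/-! ### Paths, blocking and descendants in a directed acyclic graph -/

namespace Digraph

variable {α : Type*} (G : Digraph α)

/-- `π` lists the vertices of a path from `x` to `y`: they are distinct, and successive ones are
adjacent, in either direction. -/
def IsPathBetween (π : List α) (x y : α) : Prop :=
  π.Nodup ∧ π.head? = some x ∧ π.getLast? = some y ∧
    π.IsChain (fun a b => G.Adj a b ∨ G.Adj b a)

/-- A backdoor path between `x` and `y`: a path whose first edge has an arrowhead into `x`. -/
def IsBackdoorPath (π : List α) (x y : α) : Prop :=
  G.IsPathBetween π x y ∧ ∃ w, [x, w] <+: π ∧ G.Adj w x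

/-- `b` is a collider on `π`: `a → b ← c` is a subpath of `π`. -/
def IsColliderOn (π : List α) (b : α) : Prop :=
  ∃ a c, [a, b, c] <:+: π ∧ G.Adj a b ∧ G.Adj c b

/-- `b` is an interior non-collider on `π`: it has neighbours `a`, `c` on `π`, and `a ← b` or
`b → c`. -/
def IsNonColliderOn (π : List α) (b : α) : Prop :=
  ∃ a c, [a, b, c] <:+: π ∧ (G.Adj b a ∨ G.Adj b c)

/-- `v` is a descendant of `u`; every vertex is its own descendant. -/
def IsDescendant (u v : α) : Prop := Relation.ReflTransGen G.Adj u v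

/-- The path `π` between `x` and `y` is active given `Z`. -/
def IsActive (Z : Set α) (π : List α) (x y : α) : Prop :=
  x ∉ Z ∧ y ∉ Z ∧ (∀ b, G.IsNonColliderOn π b → b ∉ Z) ∧
    ∀ b, G.IsColliderOn π b → ∃ d ∈ Z, G.IsDescendant b d

/-- `Z` blocks the path `π` between `x` and `y`. -/
def Blocks (Z : Set α) (π : List α) (x y : α) : Prop := ¬ G.IsActive Z π x y

end Digraph

/-! ### Full-time causal graphs and their abstractions -/

/-- A full-time causal graph over the time series `V` with maximal lag `γmax`: an acyclic directed
graph on the instances `(X, t)`, `t ∈ ℤ`, in which causes do not come after their effects and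
whose edges are constant throughout time. -/
structure FTCG (V : Type*) (γmax : ℕ) extends Digraph (V × ℤ) where
  le_of_adj : ∀ {u v : V × ℤ}, Adj u v → u.2 ≤ v.2
  lag_le : ∀ {u v : V × ℤ}, Adj u v → v.2 - u.2 ≤ γmax
  shift : ∀ (X Y : V) (s t k : ℤ), Adj (X, s) (Y, t) ↔ Adj (X, s + k) (Y, t + k)
  acyclic : ∀ u, ¬ Relation.TransGen Adj u u

/-- The vertices of an extended summary causal graph: `X_{t^-}` and `X_t` for every series `X`. -/
inductive ESCGVertex (V : Type*) where
  | past (X : V)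
  | present (X : V)

namespace FTCG

variable {V : Type*} {γmax : ℕ} (F : FTCG V γmax)

/-- `X_{t-k} → Y_t` (for one, equivalently for every, time `t`). -/
def LagAdj (X : V) (k : ℕ) (Y : V) : Prop := F.Adj (X, -(k : ℤ)) (Y, 0)

/-- The parents of `Y` in relative time: the pairs `(X, k)` with `X_{t-k} → Y_t`. -/
abbrev Pa (Y : V) : Type _ := {p : V × ℕ // F.LagAdj p.1 p.2 Y}

/-- The extended summary causal graph derived from `F`. -/
def escg : Digraph (ESCGVertex V) where
  Adj
    | .present X, .present Y => F.LagAdj X 0 Y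
    | .past X, .present Y => ∃ k : ℕ, 0 < k ∧ k ≤ γmax ∧ F.LagAdj X k Y
    | _, .past _ => False

/-- The summary causal graph derived from `F`. -/
def scg : Digraph V where
  Adj X Y := ∃ k : ℕ, k ≤ γmax ∧ F.LagAdj X k Y

theorem adj_of_lagAdj {X Y : V} {k : ℕ} (h : F.LagAdj X k Y) (t : ℤ) :
    F.Adj (X, t - k) (Y, t) := by
  have := (F.shift X Y _ _ t).1 h
  simpa [sub_eq_neg_add] using this

/-- From any starting time on, edges can only be followed backwards finitely often. -/
theorem wellFounded_from [Finite V] (s : ℤ) :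
    WellFounded (fun u w : V × ℤ => F.Adj u w ∧ s ≤ u.2) := by
  let r : V → V → Prop := Relation.TransGen (fun a b => F.Adj (a, 0) (b, 0))
  have hirr : Std.Irrefl r := ⟨fun a h => F.acyclic (a, 0)
    (Relation.TransGen.lift (p := F.Adj) (fun v : V => ((v, 0) : V × ℤ)) (fun _ _ h => h) _ _
      h)⟩
  have htr : IsTrans V r := ⟨fun _ _ _ => Relation.TransGen.trans⟩
  have hr : WellFounded r := Finite.wellFounded_of_trans_of_irrefl r
  have hlex : WellFounded (Prod.Lex (fun a b : ℕ => a < b) r) :=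
    WellFounded.prod_lex Nat.lt_wfRel.wf hr
  refine Subrelation.wf ?_ (InvImage.wf (fun u : V × ℤ => ((u.2 - s).toNat, u.1)) hlex)
  rintro ⟨X, a⟩ ⟨Y, b⟩ ⟨hadj, hs⟩
  have hle : a ≤ b := F.le_of_adj hadj
  have hs' : s ≤ a := hs
  rcases hle.lt_or_eq with hlt | rfl
  · exact Prod.Lex.left _ _ (by omega)
  · refine Prod.Lex.right _ (Relation.TransGen.single ?_)
    have := (F.shift X Y a a (-a)).1 hadj
    simpa using this

end FTCG

/-- An extended summary causal graph or a summary causal graph over the series `V`. -/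
inductive CausalAbstraction (V : Type*) where
  | escg (G : Digraph (ESCGVertex V))
  | scg (G : Digraph V)

namespace CausalAbstraction

variable {V : Type*}

/-- The candidate full-time causal graphs of `G`: those from which `G` is derived. -/
def candidates (γmax : ℕ) : CausalAbstraction V → Set (FTCG V γmax)
  | .escg G => {F | F.escg = G}
  | .scg G => {F | F.scg = G}

/-- The backdoor criterion over all candidate full-time causal graphs, relative to `(x, y)`. -/
def SatisfiesBackdoor (γmax : ℕ) (G : CausalAbstraction V) (x y : V × ℤ) (Z : Set (V × ℤ)) :
    Prop :=
  ∀ F ∈ G.candidates γmax,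
    (∀ π, F.IsBackdoorPath π x y → F.Blocks Z π x y) ∧ ∀ z ∈ Z, ¬ F.IsDescendant x z

end CausalAbstraction

/-! ### Dynamic structural causal models -/

/-- The trajectories of time series in which the series `X` has the state space `S X`. -/
abbrev Trajectory {V : Type*} (S : V → Type*) : Type _ := ∀ u : V × ℤ, S u.1

/-- A dynamic structural causal model with full-time causal graph `F` and state spaces `S`.
The structural function of a series reads its parents and its own noise and does not depend on
time (consistency throughout time). The noises are jointly independent, and every variable is
determined by the noises of its ancestors, so that no two observed variables have a hidden common
cause (causal sufficiency), not even one in the infinitely remote past. -/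
structure DSCM {V : Type*} {γmax : ℕ} (S : V → Type*) [∀ X, MeasurableSpace (S X)]
    (F : FTCG V γmax) where
  /-- The probability space that carries the noises. -/
  Ω : Type w
  [measurableSpaceΩ : MeasurableSpace Ω]
  /-- The probability measure on it. -/
  μ : Measure Ω
  [isProbabilityMeasure : IsProbabilityMeasure μ]
  /-- The space of values of the noise of each series. -/
  Noise : V → Type w
  [measurableSpaceNoise : ∀ X, MeasurableSpace (Noise X)]
  /-- The noises. -/
  noise : ∀ u : V × ℤ, Ω → Noise u.1
  /-- The structural functions. -/
  f : ∀ X : V, (∀ p : F.Pa X, S p.1.1) → Noise X → S X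
  /-- The observed variables. -/
  val : ∀ u : V × ℤ, Ω → S u.1
  measurable_noise : ∀ u, Measurable (noise u)
  indep_noise : iIndepFun noise μ
  measurable_f : ∀ X, Measurable (fun a : (∀ p : F.Pa X, S p.1.1) × Noise X => f X a.1 a.2)
  measurable_val : ∀ u, Measurable[⨆ a ∈ {a | F.IsDescendant a u},
    MeasurableSpace.comap (noise a) (measurableSpaceNoise a.1)] (val u)
  structural_eq : ∀ (X : V) (t : ℤ) (ω : Ω),
    val (X, t) ω = f X (fun p => val (p.1.1, t - p.1.2) ω) (noise (X, t) ω)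

attribute [instance] DSCM.measurableSpaceΩ DSCM.isProbabilityMeasure DSCM.measurableSpaceNoise

namespace DSCM

variable {V : Type*} {γmax : ℕ} {S : V → Type*} [∀ X, MeasurableSpace (S X)] {F : FTCG V γmax}
  (M : DSCM S F)

/-- The joint distribution `P` of the observed variables. -/
noncomputable def law : Measure (Trajectory S) := M.μ.map (fun ω u => M.val u ω)

open Classical in
/-- The variables under the intervention `do(x₀ = a)`: the structural equation of the variable
`x₀` is replaced by the constant `a`, all other structural equations are kept. What happens before
the intervention is unchanged; from then on the values are computed recursively. -/
noncomputable def doVal [Finite V] (x₀ : V × ℤ) (a : S x₀.1) (ω : M.Ω) : ∀ u : V × ℤ, S u.1 :=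
  (F.wellFounded_from x₀.2).fix fun u rec =>
    if h : u = x₀ then h ▸ a
    else if u.2 < x₀.2 then M.val u ω
    else M.f u.1
      (fun p => if hp : x₀.2 ≤ u.2 - p.1.2 then
          rec (p.1.1, u.2 - p.1.2) ⟨F.adj_of_lagAdj p.2 u.2, hp⟩
        else M.val (p.1.1, u.2 - p.1.2) ω)
      (M.noise u ω)

theorem doVal_self [Finite V] (x₀ : V × ℤ) (a : S x₀.1) (ω : M.Ω) :
    M.doVal x₀ a ω x₀ = a := by
  rw [doVal, WellFounded.fix_eq]
  simp

theorem doVal_of_lt [Finite V] (x₀ : V × ℤ) (a : S x₀.1) (ω : M.Ω) {u : V × ℤ}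
    (hu : u.2 < x₀.2) : M.doVal x₀ a ω u = M.val u ω := by
  have hne : u ≠ x₀ := by rintro rfl; exact lt_irrefl _ hu
  rw [doVal, WellFounded.fix_eq]
  simp [hne, hu]

theorem doVal_structural_eq [Finite V] (x₀ : V × ℤ) (a : S x₀.1) (ω : M.Ω) (X : V) (t : ℤ)
    (hne : (X, t) ≠ x₀) :
    M.doVal x₀ a ω (X, t) =
      M.f X (fun p => M.doVal x₀ a ω (p.1.1, t - p.1.2)) (M.noise (X, t) ω) := by
  by_cases ht : t < x₀.2
  · rw [M.doVal_of_lt x₀ a ω (u := (X, t)) ht, M.structural_eq]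
    congr 1
    funext p
    rw [M.doVal_of_lt]
    show t - (p.1.2 : ℤ) < x₀.2
    omega
  · conv_lhs => rw [doVal, WellFounded.fix_eq]
    rw [dif_neg hne, if_neg ht]
    congr 1
    funext p
    by_cases hp : x₀.2 ≤ t - p.1.2
    · simp only [dif_pos hp]
      rfl
    · rw [dif_neg hp, M.doVal_of_lt]
      exact not_le.1 hp

/-- The total effect `P(y₀ = b | do(x₀ = a))`. -/
noncomputable def totalEffect [Finite V] (x₀ y₀ : V × ℤ) (a : S x₀.1) (b : S y₀.1) : ENNReal :=
  M.μ {ω | M.doVal x₀ a ω y₀ = b}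

end DSCM

section Identification

variable {V : Type*} {S : V → Type*} [∀ X, MeasurableSpace (S X)]

/-- Positivity of a joint distribution of discrete variables: finitely many variables take any
prescribed values with positive probability. -/
def IsPositiveLaw (P : Measure (Trajectory S)) : Prop :=
  ∀ (A : Finset (V × ℤ)) (h₀ : Trajectory S), 0 < P {h | ∀ u ∈ A, h u = h₀ u}

/-- The adjustment formula `∑_z P(y₀ = b | x₀ = a, Z = z) P(Z = z)`. -/
noncomputable def adjustment (P : Measure (Trajectory S)) (x₀ y₀ : V × ℤ) (Z : Finset (V × ℤ))
    (a : S x₀.1) (b : S y₀.1) : ENNReal :=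
  ∑' z : (∀ u : Z, S u.1.1),
    P[{h | h y₀ = b} | {h | h x₀ = a ∧ ∀ u : Z, h u.1 = z u}] * P {h | ∀ u : Z, h u.1 = z u}

/-- Identifiability of the total effect of `x₀` on `y₀` in an abstraction `G`: some do-free
formula, i.e. some function of the joint distribution of the observed variables alone, gives the
total effect in every model with positive distribution whose graph is any candidate of `G`. -/
def Identifiable [Finite V] (γmax : ℕ) (S : V → Type*) [∀ X, MeasurableSpace (S X)]
    (G : CausalAbstraction V) (x₀ y₀ : V × ℤ) : Prop :=
  ∃ Φ : Measure (Trajectory S) → S x₀.1 → S y₀.1 → ENNReal,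
    ∀ F ∈ G.candidates γmax, ∀ M : DSCM.{w} S F, IsPositiveLaw M.law →
      ∀ a b, M.totalEffect x₀ y₀ a b = Φ M.law a b

end Identification

/-! The infinite past offers no Markov factorisation to start from, so the argument works directly
with the independent noises. Delete the edges out of `x₀`; blocking all backdoor paths then means
blocking all paths (`blocks_removeOutgoing`). By `exists_separation` the ancestors of `x₀`, `y₀` and
`Z` in this graph split into a side of `x₀` and a side of `y₀`, and a parent outside `Z` lies on the
side of its child.

Hold `x₀` and `Z` fixed at prescribed values. Every edge that crosses between the sides starts at a
fixed vertex and carries a constant, so each side is a function of its own noises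
(`measurable_fixedVal`). Since `Z` contains no descendant of `x₀`, the event that `Z` takes the
prescribed values can be read off in the fixed system (`val_eq_iff_mechanism_eq`). It is an
intersection of one event per side; `x₀` adds an event on its side, the potential outcome one on the
other. Independence of the noises makes the potential outcome conditionally independent of `x₀`
given `Z` (`measure_mul_of_backdoor`).

Summing over the values of `Z`, with consistency (`doVal_of_val_eq`) and positivity, gives the
adjustment formula. It mentions only the law and `Z`, so one formula serves all candidates. -/

/-! ### Separation in directed graphs -/

namespace Digraph

variable {α : Type*} {G : Digraph α}

/-- `l` lists the vertices of a path ending in `x` on which no interior non-collider is in `Z` and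
every collider has a descendant in `Z`; the starting point of `l` may be in `Z`. -/
structure IsOpenPath (G : Digraph α) (Z : Set α) (x : α) (l : List α) : Prop where
  nodup : l.Nodup
  getLast : l.getLast? = some x
  isChain : l.IsChain (fun a b => G.Adj a b ∨ G.Adj b a)
  nonCollider : ∀ b, G.IsNonColliderOn l b → b ∉ Z
  collider : ∀ b, G.IsColliderOn l b → ∃ d ∈ Z, G.IsDescendant b d

theorem isNonColliderOn_reverse {l : List α} {b : α} :
    G.IsNonColliderOn l.reverse b ↔ G.IsNonColliderOn l b := by
  have key : ∀ l : List α, G.IsNonColliderOn l b → G.IsNonColliderOn l.reverse b := by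
    rintro l ⟨a, c, h, h'⟩
    exact ⟨c, a, by simpa using List.reverse_infix.2 h, h'.symm⟩
  exact ⟨fun h => by simpa using key _ h, key l⟩

theorem isColliderOn_reverse {l : List α} {b : α} :
    G.IsColliderOn l.reverse b ↔ G.IsColliderOn l b := by
  have key : ∀ l : List α, G.IsColliderOn l b → G.IsColliderOn l.reverse b := by
    rintro l ⟨a, c, h, h'⟩
    exact ⟨c, a, by simpa using List.reverse_infix.2 h, h'.symm⟩
  exact ⟨fun h => by simpa using key _ h, key l⟩

namespace IsOpenPath

variable {Z : Set α} {x : α}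

theorem singleton (x : α) : G.IsOpenPath Z x [x] where
  nodup := by simp
  getLast := by simp
  isChain := by simp
  nonCollider := by
    rintro b ⟨a, c, h, -⟩
    simpa using h.length_le
  collider := by
    rintro b ⟨a, c, h, -⟩
    simpa using h.length_le

theorem suffix {l l' : List α} (h : G.IsOpenPath Z x l) (hs : l' <:+ l) (hne : l' ≠ []) :
    G.IsOpenPath Z x l' where
  nodup := h.nodup.sublist hs.sublist
  getLast := by
    obtain ⟨t, rfl⟩ := hs
    rw [← h.getLast, List.getLast?_append_of_ne_nil _ hne]
  isChain := h.isChain.suffix hs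
  nonCollider := fun b ⟨a, c, hi, h'⟩ => h.nonCollider b ⟨a, c, hi.trans hs.isInfix, h'⟩
  collider := fun b ⟨a, c, hi, h'⟩ => h.collider b ⟨a, c, hi.trans hs.isInfix, h'⟩

theorem infix_cons_cons {a b c w' v : α} {l : List α} (h : [a, b, c] <:+: w' :: v :: l) :
    (a = w' ∧ b = v ∧ l.head? = some c) ∨ [a, b, c] <:+: v :: l := by
  rcases List.infix_cons_iff.1 h with h | h
  · left
    obtain ⟨t, ht⟩ := h
    simp only [List.cons_append, List.nil_append, List.cons.injEq] at ht
    obtain ⟨rfl, rfl, rfl⟩ := ht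
    simp
  · exact Or.inr h

/-- An open path can be extended by a vertex adjacent to its starting point, or truncated at
it. -/
theorem extend {v v' : α} {l : List α} (h : G.IsOpenPath Z x (v :: l))
    (hadj : G.Adj v' v ∨ G.Adj v v')
    (hnc : ∀ c, l.head? = some c → G.Adj v v' ∨ G.Adj v c → v ∉ Z)
    (hc : ∀ c, l.head? = some c → G.Adj v' v → G.Adj c v → ∃ d ∈ Z, G.IsDescendant v d) :
    ∃ l', G.IsOpenPath Z x (v' :: l') ∧ (l' = v :: l ∨ v' :: l' <:+ v :: l) := by
  by_cases hmem : v' ∈ v :: l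
  · obtain ⟨s, t, hst⟩ := List.append_of_mem hmem
    have hs : v' :: t <:+ v :: l := ⟨s, hst.symm⟩
    exact ⟨t, h.suffix hs (by simp), Or.inr hs⟩
  · refine ⟨v :: l, ⟨List.nodup_cons.2 ⟨hmem, h.nodup⟩, ?_, ?_, ?_, ?_⟩, Or.inl rfl⟩
    · simpa using h.getLast
    · exact List.isChain_cons_cons.2 ⟨hadj, h.isChain⟩
    · rintro b ⟨a, c, hi, h'⟩
      rcases infix_cons_cons hi with ⟨rfl, rfl, hh⟩ | hi
      · exact hnc c hh h'
      · exact h.nonCollider b ⟨a, c, hi, h'⟩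
    · rintro b ⟨a, c, hi, h1, h2⟩
      rcases infix_cons_cons hi with ⟨rfl, rfl, hh⟩ | hi
      · exact hc c hh h1 h2
      · exact h.collider b ⟨a, c, hi, h1, h2⟩

end IsOpenPath

/-- `v` is joined to `x` by an open path. -/
def OpenConnected (G : Digraph α) (Z : Set α) (x v : α) : Prop :=
  ∃ l, G.IsOpenPath Z x (v :: l)

variable {Z : Set α} {x y : α}

theorem OpenConnected.forward (hasymm : ∀ a b, G.Adj a b → ¬ G.Adj b a) {p u : α}
    (h : G.OpenConnected Z x p) (hp : p ∉ Z) (hpu : G.Adj p u) : G.OpenConnected Z x u := by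
  obtain ⟨l, hl⟩ := h
  obtain ⟨l', hl', -⟩ := hl.extend (Or.inr hpu) (fun _ _ _ => hp)
    (fun _ _ h1 => absurd h1 (hasymm _ _ hpu))
  exact ⟨l', hl'⟩

theorem OpenConnected.forward_of_isDescendant (hasymm : ∀ a b, G.Adj a b → ¬ G.Adj b a) {u v : α}
    (h : G.OpenConnected Z x u) (hu : ∀ d ∈ Z, ¬ G.IsDescendant u d) (huv : G.IsDescendant u v) :
    G.OpenConnected Z x v := by
  induction huv with
  | refl => exact h
  | tail h1 h2 ih => exact ih.forward hasymm (fun hz => hu _ hz h1) h2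

/-- A directed path from `u` to `x` has no colliders and cannot meet `Z`. Directedness is recorded
because it keeps `u` from becoming a collider when a parent of `u` is prepended. -/
theorem exists_directed_isOpenPath (hasymm : ∀ a b, G.Adj a b → ¬ G.Adj b a) {u : α}
    (hux : G.IsDescendant u x) (hu : ∀ d ∈ Z, ¬ G.IsDescendant u d) :
    ∃ l, G.IsOpenPath Z x (u :: l) ∧ (u :: l).IsChain G.Adj := by
  induction hux using Relation.ReflTransGen.head_induction_on with
  | refl => exact ⟨[], .singleton x, by simp⟩
  | @head u u' h1 h2 ih =>
    have hu' : ∀ d ∈ Z, ¬ G.IsDescendant u' d := fun d hd h => hu d hd (.head h1 h)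
    obtain ⟨l, hl, hdir⟩ := ih hu'
    obtain ⟨l', hl', rfl | hs⟩ := hl.extend (v' := u) (Or.inl h1)
      (fun _ _ _ hz => hu' _ hz .refl) (by
        intro c hc _ h
        cases l with
        | nil => simp at hc
        | cons d l =>
          obtain rfl : d = c := by simpa using hc
          exact absurd (List.isChain_cons_cons.1 hdir).1 (hasymm _ _ h))
    · exact ⟨_, hl', List.isChain_cons_cons.2 ⟨h1, hdir⟩⟩
    · exact ⟨l', hl', hdir.suffix hs⟩

/-- If `Z` blocks all paths between `x` and `y`, then the ancestors of `x`, `y` and `Z` fall into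
two classes, one containing `x` and the other one `y`, such that the parents outside of `Z` of a
vertex are in the same class as the vertex. -/
theorem exists_separation (hasymm : ∀ a b, G.Adj a b → ¬ G.Adj b a) (hx : x ∉ Z) (hy : y ∉ Z)
    (hsep : ∀ π, G.IsPathBetween π x y → G.Blocks Z π x y) :
    ∃ T : Set α, x ∈ T ∧ y ∉ T ∧ ∀ p u, G.Adj p u → p ∉ Z →
      (∃ v, (v = x ∨ v = y ∨ v ∈ Z) ∧ G.IsDescendant u v) → (p ∈ T ↔ u ∈ T) := by
  have hny : ¬ G.OpenConnected Z x y := by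
    rintro ⟨l, hl⟩
    refine hsep (y :: l).reverse ⟨List.nodup_reverse.2 hl.nodup, ?_, ?_, ?_⟩ ⟨hx, hy, ?_, ?_⟩
    · rw [List.head?_reverse, hl.getLast]
    · simp
    · rw [List.isChain_reverse]
      exact hl.isChain.imp fun _ _ h => h.symm
    · exact fun b hb => hl.nonCollider b (isNonColliderOn_reverse.1 hb)
    · exact fun b hb => hl.collider b (isColliderOn_reverse.1 hb)
  -- A vertex of `Z` transmits only as a collider, so it joins the class of `x` only when reached
  -- through an arrow into it from outside `Z`.
  refine ⟨{u | u ∉ Z ∧ G.OpenConnected Z x u ∨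
    u ∈ Z ∧ ∃ p, G.Adj p u ∧ p ∉ Z ∧ G.OpenConnected Z x p}, Or.inl ⟨hx, [], .singleton x⟩, ?_, ?_⟩
  · rintro (⟨-, h⟩ | ⟨h, -⟩)
    exacts [hny h, hy h]
  rintro p u hpu hp ⟨v, hv, huv⟩
  simp only [Set.mem_ofPred_eq, hp, not_false_eq_true, true_and, false_and, or_false]
  constructor
  · intro h
    by_cases hu : u ∈ Z
    · exact Or.inr ⟨hu, p, hpu, hp, h⟩
    · exact Or.inl ⟨hu, h.forward hasymm hp hpu⟩
  rintro (⟨hu, l, hl⟩ | ⟨hu, q, hqu, hq, l, hl⟩)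
  -- Prepending `p` may turn `u` into a collider. Without a descendant of `u` in `Z`, the path is
  -- replaced by a directed one if `u` is an ancestor of `x`; an ancestor of `y` would give an open
  -- path from `y` to `x`.
  · by_cases hanc : ∃ d ∈ Z, G.IsDescendant u d
    · obtain ⟨l', hl', -⟩ := hl.extend (Or.inl hpu) (fun _ _ _ => hu) (fun _ _ _ _ => hanc)
      exact ⟨l', hl'⟩
    · push Not at hanc
      rcases hv with rfl | rfl | hv
      · obtain ⟨l, hl, hdir⟩ := exists_directed_isOpenPath hasymm huv hanc
        obtain ⟨l', hl', -⟩ := hl.extend (Or.inl hpu) (fun _ _ _ => hu) (by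
          intro c hc _ h
          cases l with
          | nil => simp at hc
          | cons d l =>
            obtain rfl : d = c := by simpa using hc
            exact absurd (List.isChain_cons_cons.1 hdir).1 (hasymm _ _ h))
        exact ⟨l', hl'⟩
      · exact absurd (OpenConnected.forward_of_isDescendant hasymm ⟨l, hl⟩ hanc huv) hny
      · exact absurd huv (hanc v hv)
  -- An open path starting at `u` whose first edge points into `u`: prepending `p` then makes `u` a
  -- collider, which is open because `u` itself is in `Z`.
  · obtain ⟨m, hm, hhead⟩ : ∃ m, G.IsOpenPath Z x (u :: m) ∧
        ∀ c, m.head? = some c → G.Adj c u := by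
      obtain ⟨m, hm, rfl | hs⟩ := hl.extend (v' := u) (Or.inr hqu) (fun _ _ _ => hq)
        (fun _ _ h1 => absurd h1 (hasymm _ _ hqu))
      · refine ⟨_, hm, fun c hc => ?_⟩
        obtain rfl : q = c := by simpa using hc
        exact hqu
      · refine ⟨m, hm, fun c hc => ?_⟩
        obtain ⟨s, hs⟩ := hs
        obtain ⟨m, rfl⟩ : ∃ m', m = c :: m' := by
          cases m with
          | nil => simp at hc
          | cons d m => exact ⟨m, by simpa using hc⟩
        rcases List.eq_nil_or_concat s with rfl | ⟨s, a, rfl⟩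
        · simp only [List.nil_append, List.cons.injEq] at hs
          exact absurd (hs.1 ▸ hu) hq
        have hchain := hm.isChain.rel
        rcases hchain with h | h
        -- Since `q` is not in `Z`, `u` was interior to the old path, and an edge `u → c` would make
        -- it a non-collider in `Z`.
        · refine absurd hu (hl.nonCollider u ⟨a, c, ⟨s, m, ?_⟩, Or.inr h⟩)
          rw [← hs]; simp
        · exact h
    obtain ⟨l', hl', -⟩ := hm.extend (Or.inl hpu)
      (by
        rintro c hc (h | h)
        · exact absurd h (hasymm _ _ hpu)
        · exact absurd h (hasymm _ _ (hhead c hc)))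
      (fun _ _ _ _ => ⟨u, hu, .refl⟩)
    exact ⟨l', hl'⟩

/-- The graph `G` without the edges out of `x`. -/
def removeOutgoing (G : Digraph α) (x : α) : Digraph α where
  Adj u v := G.Adj u v ∧ u ≠ x

theorem removeOutgoing_isDescendant {u v : α} (h : (G.removeOutgoing x).IsDescendant u v) :
    G.IsDescendant u v :=
  Relation.ReflTransGen.mono (r := (G.removeOutgoing x).Adj) (fun _ _ h => h.1) _ _ h

/-- If `Z` blocks all backdoor paths between `x` and `y`, then it blocks all paths between them in
the graph without the edges out of `x`. -/
theorem blocks_removeOutgoing (hasymm : ∀ a b, G.Adj a b → ¬ G.Adj b a) (hxy : x ≠ y)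
    (hsep : ∀ π, G.IsBackdoorPath π x y → G.Blocks Z π x y) (π : List α)
    (hπ : (G.removeOutgoing x).IsPathBetween π x y) : (G.removeOutgoing x).Blocks Z π x y := by
  obtain ⟨hnd, hhead, hlast, hchain⟩ := hπ
  rintro ⟨hxZ, hyZ, hnc, hc⟩
  have key : ∀ {a b}, (G.removeOutgoing x).Adj a b ∨ (G.removeOutgoing x).Adj b a →
      G.Adj a b → (G.removeOutgoing x).Adj a b := by
    rintro a b (h | h) hab
    · exact h
    · exact absurd h.1 (hasymm _ _ hab)
  have hinfix : ∀ {a b c}, [a, b, c] <:+: π →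
      ((G.removeOutgoing x).Adj a b ∨ (G.removeOutgoing x).Adj b a) ∧
      ((G.removeOutgoing x).Adj b c ∨ (G.removeOutgoing x).Adj c b) := by
    intro a b c h
    simpa using hchain.infix h
  refine hsep π ⟨⟨hnd, hhead, hlast, hchain.imp fun _ _ h => h.imp And.left And.left⟩, ?_⟩
    ⟨hxZ, hyZ, ?_, ?_⟩
  -- With the edges out of `x` gone, the first edge of any path can only point into `x`.
  · match π, hhead, hlast, hchain with
    | [a], h1, h2, _ =>
      simp only [List.head?_cons, List.getLast?_singleton, Option.some.injEq] at h1 h2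
      exact absurd (h1.symm.trans h2) hxy
    | a :: b :: l, h1, _, h3 =>
      obtain rfl : a = x := by simpa using h1
      refine ⟨b, ⟨l, by simp⟩, ?_⟩
      rcases h3.rel with h | h
      · exact absurd rfl h.2
      · exact h.1
  · rintro b ⟨a, c, hi, h⟩
    obtain ⟨h1, h2⟩ := hinfix hi
    exact hnc b ⟨a, c, hi, h.imp (key h1.symm) (key h2)⟩
  · rintro b ⟨a, c, hi, h, h'⟩
    obtain ⟨h1, h2⟩ := hinfix hi
    obtain ⟨d, hd, hbd⟩ := hc b ⟨a, c, hi, key h1 h, key h2.symm h'⟩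
    exact ⟨d, hd, removeOutgoing_isDescendant hbd⟩

end Digraph

/-! ### Models in which several variables are held fixed -/

namespace FTCG

variable {V : Type*} {γmax : ℕ} (F : FTCG V γmax)

theorem not_adj_of_adj (u v : V × ℤ) (h : F.Adj u v) : ¬ F.Adj v u :=
  fun h' => F.acyclic u (.tail (.single h) h')

theorem le_of_isDescendant {u v : V × ℤ} (h : F.IsDescendant u v) : u.2 ≤ v.2 := by
  induction h with
  | refl => exact le_rfl
  | tail _ h ih => exact ih.trans (F.le_of_adj h)

theorem not_isDescendant_of_adj {p u : V × ℤ} (h : F.Adj p u) : ¬ F.IsDescendant u p :=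
  fun h' => F.acyclic u (Relation.TransGen.tail' h' h)

/-- Induction along the edges of the graph from the time `s` on. -/
theorem induction_from [Finite V] (s : ℤ) {P : V × ℤ → Prop} (base : ∀ u, u.2 < s → P u)
    (step : ∀ u, s ≤ u.2 → (∀ p, F.Adj p u → P p) → P u) (u : V × ℤ) : P u := by
  induction u using (F.wellFounded_from s).induction with
  | _ u ih =>
    by_cases hu : u.2 < s
    · exact base u hu
    · refine step u (not_lt.1 hu) fun p hp => ?_
      by_cases hps : p.2 < s
      · exact base p hps
      · exact ih p ⟨hp, not_lt.1 hps⟩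

end FTCG

namespace DSCM

variable {V : Type*} {γmax : ℕ} {S : V → Type*} [∀ X, MeasurableSpace (S X)] {F : FTCG V γmax}
  (M : DSCM S F)

/-- The value that the structural equation of `u` gives when its parents take their values
in `g`. -/
def mechanism (g : Trajectory S) (ω : M.Ω) (u : V × ℤ) : S u.1 :=
  M.f u.1 (fun p => g (p.1.1, u.2 - p.1.2)) (M.noise u ω)

theorem mechanism_congr {g g' : Trajectory S} {ω : M.Ω} {u : V × ℤ}
    (h : ∀ p, F.Adj p u → g p = g' p) : M.mechanism g ω u = M.mechanism g' ω u := by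
  unfold mechanism
  congr 1
  funext p
  exact h _ (F.adj_of_lagAdj p.2 u.2)

theorem val_eq_mechanism (u : V × ℤ) (ω : M.Ω) :
    M.val u ω = M.mechanism (fun v => M.val v ω) ω u :=
  M.structural_eq u.1 u.2 ω

theorem doVal_eq_mechanism [Finite V] {x₀ : V × ℤ} {a : S x₀.1} {u : V × ℤ} (hu : u ≠ x₀)
    (ω : M.Ω) : M.doVal x₀ a ω u = M.mechanism (M.doVal x₀ a ω) ω u :=
  M.doVal_structural_eq x₀ a ω u.1 u.2 hu

theorem doVal_of_not_isDescendant [Finite V] (x₀ : V × ℤ) (a : S x₀.1) (ω : M.Ω) (u : V × ℤ)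
    (hu : ¬ F.IsDescendant x₀ u) : M.doVal x₀ a ω u = M.val u ω := by
  induction u using F.induction_from x₀.2 with
  | base u h => exact M.doVal_of_lt x₀ a ω h
  | step u _ ih =>
    rw [M.doVal_eq_mechanism (by rintro rfl; exact hu .refl), M.val_eq_mechanism]
    exact M.mechanism_congr fun p hp => ih p hp fun h => hu (h.tail hp)

/-- Consistency: imposing the value that `x₀` takes anyway changes no structural equation's outcome.
This turns potential outcomes into observed ones. -/
theorem doVal_of_val_eq [Finite V] (x₀ : V × ℤ) (a : S x₀.1) (ω : M.Ω) (ha : M.val x₀ ω = a)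
    (u : V × ℤ) : M.doVal x₀ a ω u = M.val u ω := by
  induction u using F.induction_from x₀.2 with
  | base u h => exact M.doVal_of_lt x₀ a ω h
  | step u _ ih =>
    by_cases hu : u = x₀
    · subst hu
      rw [M.doVal_self, ha]
    · rw [M.doVal_eq_mechanism hu, M.val_eq_mechanism]
      exact M.mechanism_congr ih

open Classical in
/-- The variables when those in `I` are held fixed at their values in `h`. Before the time `s`
nothing is changed; from then on the values are computed recursively. -/
noncomputable def fixedVal [Finite V] (I : Set (V × ℤ)) (h : Trajectory S) (s : ℤ) (ω : M.Ω) :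
    Trajectory S :=
  (F.wellFounded_from s).fix fun u rec =>
    if u ∈ I then h u
    else if u.2 < s then M.val u ω
    else M.f u.1
      (fun p => if hp : s ≤ u.2 - p.1.2 then
          rec (p.1.1, u.2 - p.1.2) ⟨F.adj_of_lagAdj p.2 u.2, hp⟩
        else M.val (p.1.1, u.2 - p.1.2) ω)
      (M.noise u ω)

section FixedVal

variable [Finite V] {I : Set (V × ℤ)} (h : Trajectory S) {s : ℤ} (ω : M.Ω)

theorem fixedVal_of_mem {u : V × ℤ} (hu : u ∈ I) : M.fixedVal I h s ω u = h u := by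
  rw [fixedVal, WellFounded.fix_eq]
  simp [hu]

theorem fixedVal_of_lt (hI : ∀ v ∈ I, s ≤ v.2) {u : V × ℤ} (hu : u.2 < s) :
    M.fixedVal I h s ω u = M.val u ω := by
  have hne : u ∉ I := fun hu' => (hI u hu').not_gt hu
  rw [fixedVal, WellFounded.fix_eq]
  simp [hne, hu]

theorem fixedVal_eq_mechanism (hI : ∀ v ∈ I, s ≤ v.2) {u : V × ℤ} (hu : u ∉ I) :
    M.fixedVal I h s ω u = M.mechanism (M.fixedVal I h s ω) ω u := by
  by_cases ht : u.2 < s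
  · rw [M.fixedVal_of_lt h ω hI ht, M.val_eq_mechanism]
    exact M.mechanism_congr fun p hp =>
      (M.fixedVal_of_lt h ω hI ((F.le_of_adj hp).trans_lt ht)).symm
  · conv_lhs => rw [fixedVal, WellFounded.fix_eq]
    rw [if_neg hu, if_neg ht]
    unfold mechanism
    congr 1
    funext p
    by_cases hp : s ≤ u.2 - p.1.2
    · simp only [dif_pos hp]
      rfl
    · rw [dif_neg hp, M.fixedVal_of_lt h ω hI (not_le.1 hp)]

theorem eq_fixedVal (hI : ∀ v ∈ I, s ≤ v.2) {g : Trajectory S} (hgI : ∀ v ∈ I, g v = h v)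
    (hgs : ∀ u, u.2 < s → g u = M.val u ω) (hg : ∀ u ∉ I, g u = M.mechanism g ω u)
    (u : V × ℤ) : g u = M.fixedVal I h s ω u := by
  induction u using F.induction_from s with
  | base u hu => rw [hgs u hu, M.fixedVal_of_lt h ω hI hu]
  | step u _ ih =>
    by_cases hu : u ∈ I
    · rw [hgI u hu, M.fixedVal_of_mem h ω hu]
    · rw [hg u hu, M.fixedVal_eq_mechanism h ω hI hu]
      exact M.mechanism_congr ih

end FixedVal

/-- The σ-algebra generated by the noises of the variables in `B`. -/
abbrev noiseSigma (B : Set (V × ℤ)) : MeasurableSpace M.Ω :=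
  ⨆ b ∈ B, MeasurableSpace.comap (M.noise b) (M.measurableSpaceNoise b.1)

theorem comap_noise_le (b : V × ℤ) :
    MeasurableSpace.comap (M.noise b) (M.measurableSpaceNoise b.1) ≤ M.measurableSpaceΩ :=
  (M.measurable_noise b).comap_le

theorem noiseSigma_le (B : Set (V × ℤ)) : M.noiseSigma B ≤ M.measurableSpaceΩ :=
  iSup₂_le fun b _ => M.comap_noise_le b

theorem noiseSigma_mono {B B' : Set (V × ℤ)} (h : B ⊆ B') :
    M.noiseSigma B ≤ M.noiseSigma B' :=
  biSup_mono h

theorem indep_noiseSigma {B B' : Set (V × ℤ)} (h : Disjoint B B') :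
    Indep (M.noiseSigma B) (M.noiseSigma B') M.μ :=
  indep_iSup_of_disjoint M.comap_noise_le M.indep_noise h

theorem measurable_val' (u : V × ℤ) : Measurable (M.val u) :=
  (M.measurable_val u).mono (M.noiseSigma_le _) le_rfl

theorem law_apply {E : Set (Trajectory S)} (hE : MeasurableSet E) :
    M.law E = M.μ {ω | (fun u => M.val u ω) ∈ E} :=
  Measure.map_apply (measurable_pi_lambda _ fun u => M.measurable_val' u) hE

theorem measurable_mechanism {B : Set (V × ℤ)} {g : M.Ω → Trajectory S} {u : V × ℤ} (hu : u ∈ B)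
    (hg : ∀ p, F.Adj p u → Measurable[M.noiseSigma B] fun ω => g ω p) :
    Measurable[M.noiseSigma B] fun ω => M.mechanism (g ω) ω u := by
  have hn : Measurable[M.noiseSigma B] (M.noise u) :=
    Measurable.mono (comap_measurable (M.noise u))
      (le_iSup₂ (f := fun b (_ : b ∈ B) =>
        MeasurableSpace.comap (M.noise b) (M.measurableSpaceNoise b.1)) u hu) le_rfl
  have hp : Measurable[M.noiseSigma B]
      (fun ω (p : F.Pa u.1) => g ω (p.1.1, u.2 - p.1.2)) :=
    @measurable_pi_lambda _ _ _ (M.noiseSigma B) _ _ fun p => hg _ (F.adj_of_lagAdj p.2 u.2)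
  exact @Measurable.comp _ _ _ (M.noiseSigma B) _ _ _ _ (M.measurable_f u.1) (hp.prodMk hn)

/-- `B` is closed under parents up to the fixed vertices, and these contribute constants, so the
recursion uses no noise from outside `B`. -/
theorem measurable_fixedVal [Finite V] {I B : Set (V × ℤ)} (h : Trajectory S) {s : ℤ}
    (hI : ∀ v ∈ I, s ≤ v.2) (hB : ∀ p u, F.Adj p u → u ∈ B → p ∈ I ∨ p ∈ B) (u : V × ℤ)
    (hu : u ∈ I ∨ u ∈ B) : Measurable[M.noiseSigma B] fun ω => M.fixedVal I h s ω u := by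
  have hfix : ∀ v ∈ I, Measurable[M.noiseSigma B] fun ω => M.fixedVal I h s ω v := by
    intro v hv
    simp only [M.fixedVal_of_mem h _ hv]
    exact @measurable_const _ _ _ (M.noiseSigma B) _
  induction u using F.induction_from s with
  | base u hus =>
    have huI : u ∉ I := fun huI => (hI u huI).not_gt hus
    have huB : u ∈ B := hu.resolve_left huI
    -- Before time `s` nothing is fixed, so all ancestors of `u` stay in `B`, and causal sufficiency
    -- bounds the noises on which the value depends.
    have hanc : {a | F.IsDescendant a u} ⊆ B := by
      intro a ha
      induction ha using Relation.ReflTransGen.head_induction_on with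
      | refl => exact huB
      | @head a c h1 h2 ih =>
        refine (hB a c h1 ih).resolve_left fun haI => (hI a haI).not_gt ?_
        exact (F.le_of_isDescendant (.head h1 h2)).trans_lt hus
    simp only [M.fixedVal_of_lt h _ hI hus]
    exact (M.measurable_val u).mono (M.noiseSigma_mono hanc) le_rfl
  | step u _ ih =>
    by_cases huI : u ∈ I
    · exact hfix u huI
    · have huB : u ∈ B := hu.resolve_left huI
      simp only [M.fixedVal_eq_mechanism h _ hI huI]
      exact M.measurable_mechanism huB fun p hp => ih p hp (hB p u hp huB)

end DSCM

/-! ### Conditional independence and adjustment -/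

namespace DSCM

variable {V : Type*} {γmax : ℕ} {S : V → Type*} [∀ X, MeasurableSpace (S X)] {F : FTCG V γmax}
  (M : DSCM S F) [Finite V] {x₀ y₀ : V × ℤ} {Z : Set (V × ℤ)} (h : Trajectory S) {s : ℤ}

theorem doVal_eq_fixedVal_of_val (hI : ∀ v ∈ insert x₀ Z, s ≤ v.2)
    (hZ : ∀ z ∈ Z, ¬ F.IsDescendant x₀ z) {ω : M.Ω} (hω : ∀ v ∈ Z, M.val v ω = h v) :
    M.doVal x₀ (h x₀) ω = M.fixedVal (insert x₀ Z) h s ω := by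
  funext u
  refine M.eq_fixedVal h ω hI ?_ ?_ ?_ u
  · rintro v (rfl | hv)
    · exact M.doVal_self _ _ _
    · rw [M.doVal_of_not_isDescendant _ _ _ _ (hZ v hv), hω v hv]
  · exact fun u hu => M.doVal_of_lt _ _ _ (hu.trans_le (hI x₀ (Set.mem_insert _ _)))
  · exact fun u hu => M.doVal_eq_mechanism (fun hux => hu (Or.inl hux)) ω

/-- If the equations at `Z` return the values held there anyway, fixing `Z` on top of `x₀` has no
effect. -/
theorem doVal_eq_fixedVal_of_mechanism (hI : ∀ v ∈ insert x₀ Z, s ≤ v.2) {ω : M.Ω}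
    (hω : ∀ v ∈ Z, M.mechanism (M.fixedVal (insert x₀ Z) h s ω) ω v = h v) :
    M.doVal x₀ (h x₀) ω = M.fixedVal (insert x₀ Z) h s ω := by
  funext u
  induction u using F.induction_from s with
  | base u hu =>
    rw [M.doVal_of_lt _ _ _ (hu.trans_le (hI x₀ (Set.mem_insert _ _))),
      M.fixedVal_of_lt h ω hI hu]
  | step u _ ih =>
    by_cases hux : u = x₀
    · subst hux
      rw [M.doVal_self, M.fixedVal_of_mem h ω (Set.mem_insert _ _)]
    · rw [M.doVal_eq_mechanism hux, M.mechanism_congr ih]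
      by_cases huZ : u ∈ Z
      · rw [hω u huZ, M.fixedVal_of_mem h ω (Set.mem_insert_of_mem _ huZ)]
      · rw [← M.fixedVal_eq_mechanism h ω hI (by simp [hux, huZ])]

/-- The observed values of `Z` agree with `h` if and only if they are what the structural
equations give when `Z` is held fixed at `h`. -/
theorem val_eq_iff_mechanism_eq (hI : ∀ v ∈ insert x₀ Z, s ≤ v.2)
    (hZ : ∀ z ∈ Z, ¬ F.IsDescendant x₀ z) (ω : M.Ω) :
    (∀ v ∈ Z, M.val v ω = h v) ↔
      ∀ v ∈ Z, M.mechanism (M.fixedVal (insert x₀ Z) h s ω) ω v = h v := by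
  have hne : ∀ v ∈ Z, v ≠ x₀ := fun v hv hvx => hZ v hv (hvx ▸ .refl)
  constructor
  · intro hω v hv
    rw [← M.doVal_eq_fixedVal_of_val h hI hZ hω, ← M.doVal_eq_mechanism (hne v hv),
      M.doVal_of_not_isDescendant _ _ _ _ (hZ v hv), hω v hv]
  · intro hω v hv
    rw [← M.doVal_of_not_isDescendant x₀ (h x₀) _ _ (hZ v hv), M.doVal_eq_mechanism (hne v hv),
      M.doVal_eq_fixedVal_of_mechanism h hI hω, hω v hv]

/-- The parents of `x₀` are not its descendants, so the intervention on `x₀` leaves the inputs of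
its equation unchanged. -/
theorem val_eq_mechanism_fixedVal (hI : ∀ v ∈ insert x₀ Z, s ≤ v.2)
    (hZ : ∀ z ∈ Z, ¬ F.IsDescendant x₀ z) {ω : M.Ω} (hω : ∀ v ∈ Z, M.val v ω = h v) :
    M.val x₀ ω = M.mechanism (M.fixedVal (insert x₀ Z) h s ω) ω x₀ := by
  rw [M.val_eq_mechanism, ← M.doVal_eq_fixedVal_of_val h hI hZ hω]
  exact M.mechanism_congr fun p hp =>
    (M.doVal_of_not_isDescendant _ _ _ _ (F.not_isDescendant_of_adj hp)).symm

/-- Under the backdoor criterion, the potential outcome `y₀` under `do(x₀ = h x₀)` is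
conditionally independent of the observed `x₀` given `Z`. -/
theorem measure_mul_of_backdoor [∀ X, MeasurableSingletonClass (S X)] (hfin : Z.Finite)
    (hne : x₀ ≠ y₀) (hback : ∀ π, F.IsBackdoorPath π x₀ y₀ → F.Blocks Z π x₀ y₀)
    (hZ : ∀ z ∈ Z, ¬ F.IsDescendant x₀ z) (b : S y₀.1) :
    M.μ {ω | M.val x₀ ω = h x₀ ∧ (∀ v ∈ Z, M.val v ω = h v) ∧ M.doVal x₀ (h x₀) ω y₀ = b} *
        M.μ {ω | ∀ v ∈ Z, M.val v ω = h v} =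
      M.μ {ω | M.val x₀ ω = h x₀ ∧ ∀ v ∈ Z, M.val v ω = h v} *
        M.μ {ω | (∀ v ∈ Z, M.val v ω = h v) ∧ M.doVal x₀ (h x₀) ω y₀ = b} := by
  -- The separation needs `y₀ ∉ Z`. Otherwise the outcome is determined by the values of `Z` and the
  -- identity is trivial.
  by_cases hy : y₀ ∈ Z
  · have hval : ∀ ω, (∀ v ∈ Z, M.val v ω = h v) → M.doVal x₀ (h x₀) ω y₀ = h y₀ := fun ω hω => by
      rw [M.doVal_of_not_isDescendant _ _ _ _ (hZ y₀ hy), hω y₀ hy]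
    by_cases hb : h y₀ = b
    · congr 2
      · ext ω
        exact ⟨fun hω => ⟨hω.1, hω.2.1⟩, fun hω => ⟨hω.1, hω.2, (hval ω hω.2).trans hb⟩⟩
      · ext ω
        exact ⟨fun hω => ⟨hω, (hval ω hω).trans hb⟩, fun hω => hω.1⟩
    · have h1 : {ω | M.val x₀ ω = h x₀ ∧ (∀ v ∈ Z, M.val v ω = h v) ∧
          M.doVal x₀ (h x₀) ω y₀ = b} = ∅ :=
        Set.eq_empty_of_forall_notMem fun ω hω => hb ((hval ω hω.2.1).symm.trans hω.2.2)
      have h2 : {ω | (∀ v ∈ Z, M.val v ω = h v) ∧ M.doVal x₀ (h x₀) ω y₀ = b} = ∅ :=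
        Set.eq_empty_of_forall_notMem fun ω hω => hb ((hval ω hω.1).symm.trans hω.2)
      rw [h1, h2]
      simp
  obtain ⟨s, hs⟩ : ∃ s, ∀ v ∈ insert x₀ Z, s ≤ v.2 := by
    obtain ⟨s, hs⟩ := ((hfin.insert x₀).image Prod.snd).bddBelow
    exact ⟨s, fun v hv => hs ⟨v, hv, rfl⟩⟩
  have hxZ : x₀ ∉ Z := fun hx => hZ x₀ hx .refl
  obtain ⟨T, hxT, hyT, hT⟩ := Digraph.exists_separation (G := F.removeOutgoing x₀)
    (fun a b h1 h2 => F.not_adj_of_adj a b h1.1 h2.1) hxZ hy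
    (Digraph.blocks_removeOutgoing F.not_adj_of_adj hne hback)
  set A : Set (V × ℤ) := {u | ∃ v, (v = x₀ ∨ v = y₀ ∨ v ∈ Z) ∧
    (F.removeOutgoing x₀).IsDescendant u v} with hA
  have hmem : ∀ v, v = x₀ ∨ v = y₀ ∨ v ∈ Z → v ∈ A := fun v hv => ⟨v, hv, .refl⟩
  have hpar : ∀ p u, F.Adj p u → u ∈ A → p ∉ insert x₀ Z → p ∈ A ∧ (p ∈ T ↔ u ∈ T) := by
    intro p u hpu hu hp
    rw [Set.mem_insert_iff, not_or] at hp
    have hpu' : (F.removeOutgoing x₀).Adj p u := ⟨hpu, hp.1⟩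
    refine ⟨?_, hT p u hpu' hp.2 hu⟩
    obtain ⟨v, hv, huv⟩ := hu
    exact ⟨v, hv, .head hpu' huv⟩
  have hB₁ : ∀ p u, F.Adj p u → u ∈ A ∩ T → p ∈ insert x₀ Z ∨ p ∈ A ∩ T := by
    intro p u hpu hu
    by_cases hp : p ∈ insert x₀ Z
    · exact Or.inl hp
    · obtain ⟨h1, h2⟩ := hpar p u hpu hu.1 hp
      exact Or.inr ⟨h1, h2.2 hu.2⟩
  have hB₂ : ∀ p u, F.Adj p u → u ∈ A ∩ Tᶜ → p ∈ insert x₀ Z ∨ p ∈ A ∩ Tᶜ := by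
    intro p u hpu hu
    by_cases hp : p ∈ insert x₀ Z
    · exact Or.inl hp
    · obtain ⟨h1, h2⟩ := hpar p u hpu hu.1 hp
      exact Or.inr ⟨h1, fun hpT => hu.2 (h2.1 hpT)⟩
  set W : M.Ω → Trajectory S := M.fixedVal (insert x₀ Z) h s with hW
  have hmech : ∀ B : Set (V × ℤ), (∀ p u, F.Adj p u → u ∈ B → p ∈ insert x₀ Z ∨ p ∈ B) →
      ∀ v ∈ B, MeasurableSet[M.noiseSigma B] {ω | M.mechanism (W ω) ω v = h v} := by
    intro B hB v hv
    exact M.measurable_mechanism hv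
      (fun p hp => M.measurable_fixedVal h hs hB p (hB p v hp hv)) (measurableSet_singleton (h v))
  have hall : ∀ B : Set (V × ℤ), (∀ p u, F.Adj p u → u ∈ B → p ∈ insert x₀ Z ∨ p ∈ B) →
      MeasurableSet[M.noiseSigma B] {ω | ∀ v ∈ Z ∩ B, M.mechanism (W ω) ω v = h v} := by
    intro B hB
    have : {ω | ∀ v ∈ Z ∩ B, M.mechanism (W ω) ω v = h v} =
        ⋂ v ∈ Z ∩ B, {ω | M.mechanism (W ω) ω v = h v} := by
      ext ω
      simp only [Set.mem_ofPred_eq, Set.mem_iInter]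
    rw [this]
    exact @Set.Finite.measurableSet_biInter _ _ (M.noiseSigma B) _ _ (hfin.inter_of_left B)
      fun v hv => hmech B hB v hv.2
  -- `E₁` and `Ex` depend on the noises in `A ∩ T`, `E₂` and `Ey` on those in `A ∩ Tᶜ`; all four
  -- probabilities factor accordingly.
  set E₁ := {ω | ∀ v ∈ Z ∩ (A ∩ T), M.mechanism (W ω) ω v = h v} with hE₁
  set E₂ := {ω | ∀ v ∈ Z ∩ (A ∩ Tᶜ), M.mechanism (W ω) ω v = h v} with hE₂
  set Ex := {ω | M.mechanism (W ω) ω x₀ = h x₀} with hEx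
  set Ey := {ω | W ω y₀ = b} with hEy
  have mE₁ : MeasurableSet[M.noiseSigma (A ∩ T)] E₁ := hall _ hB₁
  have mE₂ : MeasurableSet[M.noiseSigma (A ∩ Tᶜ)] E₂ := hall _ hB₂
  have mEx : MeasurableSet[M.noiseSigma (A ∩ T)] Ex :=
    hmech _ hB₁ x₀ ⟨hmem _ (Or.inl rfl), hxT⟩
  have mEy : MeasurableSet[M.noiseSigma (A ∩ Tᶜ)] Ey :=
    M.measurable_fixedVal h hs hB₂ y₀ (Or.inr ⟨hmem _ (Or.inr (Or.inl rfl)), hyT⟩)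
      (measurableSet_singleton b)
  have hindep : Indep (M.noiseSigma (A ∩ T)) (M.noiseSigma (A ∩ Tᶜ)) M.μ :=
    M.indep_noiseSigma (disjoint_compl_right.mono Set.inter_subset_right Set.inter_subset_right)
  have hfactor : ∀ E E', MeasurableSet[M.noiseSigma (A ∩ T)] E →
      MeasurableSet[M.noiseSigma (A ∩ Tᶜ)] E' → M.μ (E ∩ E') = M.μ E * M.μ E' :=
    fun E E' hE hE' => (Indep_iff _ _ _).1 hindep E E' hE hE'
  have hiff : ∀ ω, (∀ v ∈ Z, M.val v ω = h v) ↔ ω ∈ E₁ ∩ E₂ := by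
    intro ω
    rw [M.val_eq_iff_mechanism_eq h hs hZ]
    refine ⟨fun hω => ⟨fun v hv => hω v hv.1, fun v hv => hω v hv.1⟩, fun hω v hv => ?_⟩
    by_cases hvT : v ∈ T
    · exact hω.1 v ⟨hv, hmem v (Or.inr (Or.inr hv)), hvT⟩
    · exact hω.2 v ⟨hv, hmem v (Or.inr (Or.inr hv)), hvT⟩
  have hx : ∀ ω, (∀ v ∈ Z, M.val v ω = h v) → (M.val x₀ ω = h x₀ ↔ ω ∈ Ex) := by
    intro ω hω
    rw [M.val_eq_mechanism_fixedVal h hs hZ hω]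
    rfl
  have hyW : ∀ ω, (∀ v ∈ Z, M.val v ω = h v) → (M.doVal x₀ (h x₀) ω y₀ = b ↔ ω ∈ Ey) := by
    intro ω hω
    rw [M.doVal_eq_fixedVal_of_val h hs hZ hω]
    rfl
  have e1 : {ω | M.val x₀ ω = h x₀ ∧ (∀ v ∈ Z, M.val v ω = h v) ∧
      M.doVal x₀ (h x₀) ω y₀ = b} = (E₁ ∩ Ex) ∩ (E₂ ∩ Ey) := by
    ext ω
    have h1 := hiff ω
    have h2 := hx ω
    have h3 := hyW ω
    simp only [Set.mem_inter_iff, Set.mem_ofPred_eq] at h1 ⊢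
    tauto
  have e2 : {ω | ∀ v ∈ Z, M.val v ω = h v} = E₁ ∩ E₂ := Set.ext hiff
  have e3 : {ω | M.val x₀ ω = h x₀ ∧ ∀ v ∈ Z, M.val v ω = h v} = (E₁ ∩ Ex) ∩ E₂ := by
    ext ω
    have h1 := hiff ω
    have h2 := hx ω
    simp only [Set.mem_inter_iff, Set.mem_ofPred_eq] at h1 ⊢
    tauto
  have e4 : {ω | (∀ v ∈ Z, M.val v ω = h v) ∧ M.doVal x₀ (h x₀) ω y₀ = b} =
      E₁ ∩ (E₂ ∩ Ey) := by
    ext ω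
    have h1 := hiff ω
    have h3 := hyW ω
    simp only [Set.mem_inter_iff, Set.mem_ofPred_eq] at h1 ⊢
    tauto
  have m₁ := @MeasurableSet.inter _ (M.noiseSigma (A ∩ T)) _ _ mE₁ mEx
  have m₂ := @MeasurableSet.inter _ (M.noiseSigma (A ∩ Tᶜ)) _ _ mE₂ mEy
  rw [e1, e2, e3, e4, hfactor _ _ m₁ m₂, hfactor _ _ mE₁ mE₂, hfactor _ _ m₁ mE₂,
    hfactor _ _ mE₁ m₂]
  ring

/-- The adjustment formula holds for every set that satisfies the backdoor criterion. -/
theorem totalEffect_eq_adjustment [∀ X, Countable (S X)] [∀ X, MeasurableSingletonClass (S X)]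
    (hpos : IsPositiveLaw M.law) (Z : Finset (V × ℤ)) (hne : x₀ ≠ y₀)
    (hback : ∀ π, F.IsBackdoorPath π x₀ y₀ → F.Blocks (Z : Set (V × ℤ)) π x₀ y₀)
    (hZ : ∀ z ∈ Z, ¬ F.IsDescendant x₀ z) (a : S x₀.1) (b : S y₀.1) :
    M.totalEffect x₀ y₀ a b = adjustment M.law x₀ y₀ Z a b := by
  classical
  have hxZ : x₀ ∉ Z := fun hx => hZ x₀ hx .refl
  obtain ⟨ω₀⟩ : Nonempty M.Ω := nonempty_of_isProbabilityMeasure M.μ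
  have meq : ∀ (u : V × ℤ) (c : S u.1), MeasurableSet {g : Trajectory S | g u = c} :=
    fun u c => (show Measurable fun g : Trajectory S => g u from measurable_pi_apply u)
      (measurableSet_singleton c)
  have mZ : ∀ z : (∀ u : Z, S u.1.1), MeasurableSet {g : Trajectory S | ∀ u : Z, g u.1 = z u} :=
    fun z => by
      simpa only [Set.ofPred_forall] using MeasurableSet.iInter fun u : Z => meq u.1 (z u)
  have mvZ : Measurable fun ω (u : Z) => M.val u.1 ω :=
    measurable_pi_lambda _ fun u => M.measurable_val' u.1
  have hsum : M.totalEffect x₀ y₀ a b =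
      ∑' z : (∀ u : Z, S u.1.1), M.μ {ω | (∀ u : Z, M.val u.1 ω = z u) ∧
        M.doVal x₀ a ω y₀ = b} := by
    have hset : ∀ z : (∀ u : Z, S u.1.1), {ω | (∀ u : Z, M.val u.1 ω = z u) ∧
        M.doVal x₀ a ω y₀ = b} =
        (fun ω (u : Z) => M.val u.1 ω) ⁻¹' {z} ∩ {ω | M.doVal x₀ a ω y₀ = b} := by
      intro z
      ext ω
      simp [funext_iff]
    simp only [hset]
    have hm : ∀ z : (∀ u : Z, S u.1.1),
        MeasurableSet ((fun ω (u : Z) => M.val u.1 ω) ⁻¹' {z}) :=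
      fun z => mvZ (measurableSet_singleton z)
    -- Restricting the measure to the outcome event makes countable additivity need measurability
    -- only of the events for `Z`.
    simp_rw [← Measure.restrict_apply (hm _)]
    rw [← measure_iUnion _ hm]
    · rw [← Set.preimage_iUnion, Set.iUnion_of_singleton, Set.preimage_univ,
        Measure.restrict_apply_univ, totalEffect]
    · exact fun z z' hzz => Disjoint.preimage _ (Set.disjoint_singleton.2 hzz)
  rw [hsum, adjustment]
  refine tsum_congr fun z => ?_
  -- The values of `h` away from `x₀` and `Z` are irrelevant; a realised trajectory supplies them.
  obtain ⟨h, hx, hz⟩ : ∃ h : Trajectory S, h x₀ = a ∧ ∀ u : Z, h u.1 = z u := by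
    refine ⟨fun u => if hu : u ∈ Z then z ⟨u, hu⟩ else
      Function.update (fun v => M.val v ω₀) x₀ a u, ?_, fun u => ?_⟩
    · simp [hxZ]
    · simp
  subst hx
  have hall : ∀ g : Trajectory S, (∀ u : Z, g u.1 = z u) ↔ ∀ v ∈ (Z : Set (V × ℤ)), g v = h v := by
    intro g
    simp only [← hz]
    exact ⟨fun hg v hv => hg ⟨v, hv⟩, fun hg u => hg u.1 u.2⟩
  have mxZ : MeasurableSet {g : Trajectory S | g x₀ = h x₀ ∧ ∀ u : Z, g u.1 = z u} :=
    (meq x₀ (h x₀)).inter (mZ z)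
  have hpos' : M.law {g : Trajectory S | g x₀ = h x₀ ∧ ∀ u : Z, g u.1 = z u} ≠ 0 := by
    refine ((hpos (insert x₀ Z) h).trans_le (measure_mono fun g hg => ?_)).ne'
    exact ⟨hg x₀ (Finset.mem_insert_self _ _),
      (hall g).2 fun v hv => hg v (Finset.mem_insert_of_mem hv)⟩
  have hmain := M.measure_mul_of_backdoor h Z.finite_toSet hne hback hZ b
  have hcons : {ω | M.val x₀ ω = h x₀ ∧ (∀ v ∈ (Z : Set (V × ℤ)), M.val v ω = h v) ∧
      M.doVal x₀ (h x₀) ω y₀ = b} = {ω | (fun u => M.val u ω) ∈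
        {g : Trajectory S | g x₀ = h x₀ ∧ ∀ u : Z, g u.1 = z u} ∩ {g | g y₀ = b}} := by
    ext ω
    have h1 := hall fun u => M.val u ω
    have h2 := fun hx => M.doVal_of_val_eq x₀ (h x₀) ω hx y₀
    simp only [Set.mem_inter_iff, Set.mem_ofPred_eq, h1, and_assoc]
    exact and_congr_right fun hx => by rw [h2 hx]
  rw [cond_apply mxZ, M.law_apply mxZ, M.law_apply (mxZ.inter (meq y₀ b)), M.law_apply (mZ z),
    ← hcons]
  rw [M.law_apply mxZ] at hpos'
  simp only [Set.mem_ofPred_eq, fun ω => hall fun u => M.val u ω] at hpos' ⊢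
  rw [mul_assoc, hmain, ← mul_assoc, ENNReal.inv_mul_cancel hpos' (measure_ne_top _ _), one_mul]

end DSCM

theorem mainTheorem5 {V : Type*} [Finite V]
    (S : V → Type*) [∀ X, MeasurableSpace (S X)] [∀ X, Countable (S X)]
    [∀ X, MeasurableSingletonClass (S X)]
    (γmax : ℕ) (G : CausalAbstraction V)
    (F : FTCG V γmax) (hF : F ∈ G.candidates γmax)
    (M : DSCM.{w} S F) (hM : IsPositiveLaw M.law)
    (X Y : V) (γ : ℕ) (hXY : X ≠ Y ∨ γ ≠ 0) (t : ℤ) (Z : Finset (V × ℤ))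
    (hZ : G.SatisfiesBackdoor γmax (X, t - γ) (Y, t) (Z : Set (V × ℤ))) :
    Identifiable.{w} γmax S G (X, t - γ) (Y, t) ∧
      ∀ (x : S X) (y : S Y),
        M.totalEffect (X, t - γ) (Y, t) x y = adjustment M.law (X, t - γ) (Y, t) Z x y := by
  have hne : ((X, t - γ) : V × ℤ) ≠ (Y, t) := by
    intro h
    rw [Prod.mk.injEq] at h
    rcases hXY with hXY | hγ
    · exact hXY h.1
    · omega
  have key : ∀ F' ∈ G.candidates γmax, ∀ M' : DSCM.{w} S F', IsPositiveLaw M'.law →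
      ∀ (x : S X) (y : S Y), M'.totalEffect (X, t - γ) (Y, t) x y =
        adjustment M'.law (X, t - γ) (Y, t) Z x y :=
    fun F' hF' M' hM' x y =>
      M'.totalEffect_eq_adjustment hM' Z hne (hZ F' hF').1 (hZ F' hF').2 x y
  exact ⟨⟨fun P a b => adjustment P (X, t - γ) (Y, t) Z a b, key⟩, key F hF M hM⟩
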